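/- Let $F$ be a finite field with $q$ elements (of any characteristic, odd or even) and let $n\ge 0$. Let $O^+(2n,q)$ be the group of all $F$-linear automorphisms of $F^n\times F^n$ that preserve the quadratic form of plus type $Q(x,y)=x_1y_1+\cdots+x_ny_n$. Let $g$ be a uniformly random element of $O^+(2n,q)$, let $\mathrm{Fix}(g)=\{v : gv=v\}$ be its fixed space, and let $Z_n=|\mathrm{Fix}(g)|$ be the number of its fixed vectors. Then for all integers $j\ge 0$ and $n\ge j$, \[ E[Z_n^j]=\prod_{i=1}^j (q^i+1). \] Moreover, the elements with even-dimensional and with odd-dimensional fixed space contribute, respectively, \[ E\bigl[Z_n^j\,\mathbf 1_{\dim \mathrm{Fix}(g)\text{ even}}\bigr]=\tfrac12\Bigl(\prod_{i=1}^j (q^i+1)+\delta_{n,j}\Bigr),\qquad E\bigl[Z_n^j\,\mathbf 1_{\dim \mathrm{Fix}(g)\text{ odd}}\bigr]=\tfrac12\Bigl(\prod_{i=1}^j (q^i+1)-\delta_{n,j}\Bigr), \] where $\delta_{n,j}=1$ if $n=j$ and $\delta_{n,j}=0$ otherwise; in particular, at $n=j$ the boundary terms $\pm\tfrac12$ cancel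 in the sum. -/

import Mathlib

open scoped BigOperators

/-- The quadratic form of plus type (the orthogonal sum of `n` hyperbolic planes)
`Q (x, y) = x₁ y₁ + ⋯ + xₙ yₙ` on the `2n`-dimensional space `Fⁿ × Fⁿ`. -/
def plusForm (F : Type*) [Field F] (n : ℕ) :
    QuadraticForm F ((Fin n → F) × (Fin n → F)) where
  toFun v := ∑ i, v.1 i * v.2 i
  toFun_smul a v := by
    simp only [Prod.smul_fst, Prod.smul_snd, Pi.smul_apply, smul_eq_mul, Finset.mul_sum]
    exact Finset.sum_congr rfl fun i _ => by ring
  exists_companion' :=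
    ⟨LinearMap.mk₂ F (fun v w => ∑ i, (v.1 i * w.2 i + w.1 i * v.2 i))
      (fun u v w => by
        simp only [Prod.fst_add, Prod.snd_add, Pi.add_apply, ← Finset.sum_add_distrib]
        exact Finset.sum_congr rfl fun i _ => by ring)
      (fun a v w => by
        simp only [Prod.smul_fst, Prod.smul_snd, Pi.smul_apply, smul_eq_mul, Finset.mul_sum]
        exact Finset.sum_congr rfl fun i _ => by ring)
      (fun u v w => by
        simp only [Prod.fst_add, Prod.snd_add, Pi.add_apply, ← Finset.sum_add_distrib]
        exact Finset.sum_congr rfl fun i _ => by ring)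
      (fun a v w => by
        simp only [Prod.smul_fst, Prod.smul_snd, Pi.smul_apply, smul_eq_mul, Finset.mul_sum]
        exact Finset.sum_congr rfl fun i _ => by ring),
    fun v w => by
      simp only [LinearMap.mk₂_apply, Prod.fst_add, Prod.snd_add, Pi.add_apply,
        ← Finset.sum_add_distrib]
      exact Finset.sum_congr rfl fun i _ => by ring⟩

/-- The group `O⁺(2n, F)`: all linear automorphisms of `Fⁿ × Fⁿ` that preserve the
quadratic form `plusForm F n`. -/
def orthogonalPlus (F : Type*) [Field F] (n : ℕ) :
    Subgroup (((Fin n → F) × (Fin n → F)) ≃ₗ[F] ((Fin n → F) × (Fin n → F))) where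
  carrier := {g | ∀ v, plusForm F n (g v) = plusForm F n v}
  one_mem' _ := rfl
  mul_mem' {g h} hg hh v := (hg (h v)).trans (hh v)
  inv_mem' {g} hg v := by
    have h := hg (g⁻¹ v)
    rw [← LinearEquiv.mul_apply, mul_inv_cancel] at h
    exact h.symm

noncomputable instance orthogonalPlusFintype (F : Type*) [Field F] [Fintype F] (n : ℕ) :
    Fintype (orthogonalPlus F n) :=
  haveI : Finite (((Fin n → F) × (Fin n → F)) ≃ₗ[F] ((Fin n → F) × (Fin n → F))) :=
    Finite.of_injective (fun g v => g v) DFunLike.coe_injective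
  Fintype.ofFinite _

/-- The fixed space `{v | g v = v}` of an element of `O⁺(2n, F)`. -/
def fixedSpace {F : Type*} [Field F] {n : ℕ} (g : orthogonalPlus F n) :
    Submodule F ((Fin n → F) × (Fin n → F)) where
  carrier := {v | g.1 v = v}
  add_mem' {v w} hv hw := (map_add g.1 v w).trans (congrArg₂ (· + ·) hv hw)
  zero_mem' := map_zero g.1
  smul_mem' a v hv := (map_smul g.1 a v).trans (congrArg (a • ·) hv)

/-- The number of fixed vectors of `g`. -/
noncomputable def numFixed {F : Type*} [Field F] {n : ℕ} (g : orthogonalPlus F n) : ℕ :=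
  Nat.card (fixedSpace g)

/-! Write G for the group. Z^j counts the j-tuples fixed by g, so the sum of Z^j over G is the sum
over j-tuples v of the order of the pointwise stabiliser of v. By Witt's theorem, if H is the span
of the vectors chosen so far and d = dim H < n, the orbits of the stabiliser on vectors x outside H
correspond to pairs (functional on H induced by x, Q(x)). All q^(d+1) pairs occur, and by
orbit-stabiliser each contributes the order of the current stabiliser; each of the q^d vectors in H
leaves the stabiliser unchanged. Weighting tuples by t^dim gives the factor 1 + qt and replaces t by
qt, whence the product (`sum_card_fixingSubgroup_range`).

For the parity refinement, weight g by (-1)^dim Fix(g). If some nonsingular u is orthogonal to v,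
its reflection lies in the stabiliser of v and flips the sign, so v contributes 0. Otherwise v spans
a maximal totally singular subspace, which forces j = n; every element fixing it has an
even-dimensional fixed space, and such tuples form one orbit, of total contribution |G|
(`sum_sign_mul_numFixed_pow`). Half the sum and half the difference of the two totals give the even
and odd parts. -/

/-! ### Witt's extension theorem in every characteristic -/

section QuadraticSpace

open QuadraticMap Module

variable {F V : Type*} [Field F] [AddCommGroup V] [Module F V] {Q : QuadraticForm F V}

theorem QuadraticForm.map_add_smul (Q : QuadraticForm F V) (v w : V) (s : F) :
    Q (v + s • w) = Q v + s * polar Q v w + s * s * Q w := by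
  rw [QuadraticMap.map_add Q, QuadraticMap.map_smul, polar_smul_right, smul_eq_mul, smul_eq_mul]
  ring

theorem QuadraticForm.polar_map_map {f : V → V} (hadd : ∀ x y, f (x + y) = f x + f y)
    (hf : ∀ v, Q (f v) = Q v) (x y : V) : polar Q (f x) (f y) = polar Q x y := by
  simp only [polar, ← hadd, hf]

theorem QuadraticForm.polarBilin_isRefl (Q : QuadraticForm F V) : Q.polarBilin.IsRefl := by
  intro x y h
  rw [polarBilin_apply_apply] at h ⊢
  rw [polar_comm, h]

variable [FiniteDimensional F V]

theorem QuadraticForm.exists_equiv_of_preserves (hQ : Q.polarBilin.Nondegenerate) (f : V →ₗ[F] V)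
    (hf : ∀ v, Q (f v) = Q v) : ∃ g : V ≃ₗ[F] V, (∀ v, Q (g v) = Q v) ∧ ∀ v, g v = f v := by
  have hinj : Function.Injective f := by
    rw [injective_iff_map_eq_zero]
    intro x hx
    refine hQ.1 x fun y => ?_
    rw [polarBilin_apply_apply, ← QuadraticForm.polar_map_map (map_add f) hf, hx, polar_zero_left]
  exact ⟨LinearEquiv.ofInjectiveEndo f hinj, hf, fun v => rfl⟩

theorem QuadraticForm.exists_reflection (hQ : Q.polarBilin.Nondegenerate) {u : V} (hu : Q u ≠ 0) :
    ∃ r : V ≃ₗ[F] V, (∀ v, Q (r v) = Q v) ∧ ∀ v, r v = v + (-(Q u)⁻¹ * polar Q v u) • u := by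
  refine QuadraticForm.exists_equiv_of_preserves hQ
    (LinearMap.id + ((-(Q u)⁻¹) • Q.polarBilin.flip u).smulRight u) fun v => ?_
  change Q (v + (-(Q u)⁻¹ * polar Q v u) • u) = Q v
  rw [QuadraticForm.map_add_smul]
  field_simp
  ring

/-- Siegel transformations, and the scalings of hyperbolic pairs below, replace reflections in
Witt's extension step when the difference of the two vectors is singular. -/
theorem QuadraticForm.exists_siegel (hQ : Q.polarBilin.Nondegenerate) {u a : V} (hu : Q u = 0)
    (hau : polar Q a u = 0) :
    ∃ g : V ≃ₗ[F] V, (∀ v, Q (g v) = Q v) ∧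
      ∀ v, g v = v + polar Q v u • a + (-polar Q v a - Q a * polar Q v u) • u := by
  refine QuadraticForm.exists_equiv_of_preserves hQ
    (LinearMap.id + (Q.polarBilin.flip u).smulRight a +
      (-Q.polarBilin.flip a - Q a • Q.polarBilin.flip u).smulRight u) fun v => ?_
  change Q (v + polar Q v u • a + (-polar Q v a - Q a * polar Q v u) • u) = Q v
  rw [QuadraticForm.map_add_smul, QuadraticForm.map_add_smul, polar_add_left, polar_smul_left,
    hau, hu, smul_eq_mul]
  ring

theorem QuadraticForm.exists_hyperbolic_scaling (hQ : Q.polarBilin.Nondegenerate) {u w : V}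
    (hu : Q u = 0) (hw : Q w = 0) (huw : polar Q u w = 1) {c : F} (hc : c ≠ 0) :
    ∃ g : V ≃ₗ[F] V, (∀ v, Q (g v) = Q v) ∧
      ∀ v, g v = v + ((c - 1) * polar Q v w) • u + ((c⁻¹ - 1) * polar Q v u) • w := by
  refine QuadraticForm.exists_equiv_of_preserves hQ
    (LinearMap.id + ((c - 1) • Q.polarBilin.flip w).smulRight u +
      ((c⁻¹ - 1) • Q.polarBilin.flip u).smulRight w) fun v => ?_
  change Q (v + ((c - 1) * polar Q v w) • u + ((c⁻¹ - 1) * polar Q v u) • w) = Q v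
  rw [QuadraticForm.map_add_smul, QuadraticForm.map_add_smul, polar_add_left, polar_smul_left,
    huw, hu, hw, smul_eq_mul]
  field_simp
  ring

/-- In a nondegenerate space, a vector outside `H` is separated from `H` by a vector orthogonal
to `H`. -/
theorem QuadraticForm.exists_orthogonal_polar_eq_one (hQ : Q.polarBilin.Nondegenerate)
    {H : Submodule F V} {x : V} (hx : x ∉ H) :
    ∃ a, (∀ h ∈ H, polar Q h a = 0) ∧ polar Q x a = 1 := by
  have h1 : x ∉ LinearMap.BilinForm.orthogonal Q.polarBilin
      (LinearMap.BilinForm.orthogonal Q.polarBilin H) := by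
    rwa [LinearMap.BilinForm.orthogonal_orthogonal hQ (polarBilin_isRefl Q)]
  rw [LinearMap.BilinForm.mem_orthogonal_iff] at h1
  push Not at h1
  obtain ⟨a, ha, hax⟩ := h1
  rw [polarBilin_apply_apply, polar_comm] at hax
  refine ⟨(polar Q x a)⁻¹ • a, fun h hh => ?_, ?_⟩
  · have := ha h hh
    rw [polarBilin_apply_apply] at this
    rw [polar_smul_right, this, smul_zero]
  · rw [polar_smul_right, smul_eq_mul, inv_mul_cancel₀ hax]

/-- The extension step of Witt's theorem. -/
theorem QuadraticForm.exists_isometry_fixing (hQ : Q.polarBilin.Nondegenerate) {H : Submodule F V}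
    {x y : V} (hxy : Q x = Q y) (hH : ∀ h ∈ H, polar Q h x = polar Q h y)
    (hx : x ∈ H → x = y) (hy : y ∈ H → x = y) :
    ∃ g : V ≃ₗ[F] V, (∀ v, Q (g v) = Q v) ∧ (∀ h ∈ H, g h = h) ∧ g x = y := by
  by_cases hne : x = y
  · exact ⟨LinearEquiv.refl F V, fun _ => rfl, fun _ _ => rfl, hne⟩
  replace hx : x ∉ H := fun h => hne (hx h)
  replace hy : y ∉ H := fun h => hne (hy h)
  obtain ⟨u, rfl⟩ : ∃ u, y = x + u := ⟨y - x, by abel⟩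
  have hHu : ∀ h ∈ H, polar Q h u = 0 := fun h hh => by
    have := hH h hh
    rw [polar_add_right] at this
    exact left_eq_add.1 this
  have hpol : polar Q x u = -Q u := by
    rw [QuadraticMap.map_add Q] at hxy
    linear_combination -hxy
  by_cases hu : Q u = 0
  · rw [hu, neg_zero] at hpol
    -- Here u = y - x is singular and orthogonal to H and x, so no reflection in u exists. If x = h
    -- + c u then y = h + (c + 1) u, and scaling u by (c + 1)/c while fixing H suffices.
    by_cases hxu : x ∈ H ⊔ Submodule.span F {u}
    · obtain ⟨h, hh, z, hz, rfl⟩ := Submodule.mem_sup.1 hxu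
      obtain ⟨c, rfl⟩ := Submodule.mem_span_singleton.1 hz
      have huH : u ∉ H := fun hu' => hx (H.add_mem hh (H.smul_mem c hu'))
      have hc : c ≠ 0 := by
        rintro rfl
        exact hx (by simpa using hh)
      have hc' : c + 1 ≠ 0 := by
        intro hc'
        apply hy
        have : h + c • u + u = h + (c + 1) • u := by rw [add_smul, one_smul, add_assoc]
        rw [this, hc', zero_smul, add_zero]
        exact hh
      -- Subtracting Q(w) u makes w singular, giving a hyperbolic pair orthogonal to H.
      obtain ⟨w, hwH, huw⟩ := QuadraticForm.exists_orthogonal_polar_eq_one hQ huH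
      have hw' : Q (w + (-Q w) • u) = 0 := by
        rw [QuadraticForm.map_add_smul, hu, polar_comm, huw]
        ring
      have huw' : polar Q u (w + (-Q w) • u) = 1 := by
        rw [polar_add_right, polar_smul_right, polar_self, hu, huw]
        simp
      obtain ⟨g, hg, hgv⟩ := QuadraticForm.exists_hyperbolic_scaling hQ hu hw' huw'
        (div_ne_zero hc' hc)
      have hgH : ∀ h ∈ H, g h = h := fun h hh => by
        rw [hgv, hHu h hh, polar_add_right, polar_smul_right, hwH h hh, hHu h hh]
        simp
      refine ⟨g, hg, hgH, ?_⟩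
      have hgu : g u = ((c + 1) / c) • u := by
        rw [hgv, huw', polar_self, hu]
        simp only [smul_zero, mul_zero, zero_smul, add_zero, mul_one, sub_smul, one_smul]
        abel
      rw [_root_.map_add, _root_.map_smul, hgH h hh, hgu, smul_smul, mul_div_cancel₀ _ hc,
        add_smul, one_smul, add_assoc]
    -- With a orthogonal to H and u and pairing to 1 with x, the Siegel transformation of u and -a
    -- sends x to x + u.
    · obtain ⟨a, haH, hxa⟩ := QuadraticForm.exists_orthogonal_polar_eq_one hQ hxu
      have hua : polar Q (-a) u = 0 := by
        rw [polar_neg_left, polar_comm, haH u (Submodule.mem_sup_right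
          (Submodule.mem_span_singleton_self u)), neg_zero]
      obtain ⟨g, hg, hgv⟩ := QuadraticForm.exists_siegel hQ hu hua
      refine ⟨g, hg, fun h hh => ?_, ?_⟩
      · rw [hgv, hHu h hh, polar_neg_right, haH h (Submodule.mem_sup_left hh)]
        simp
      · rw [hgv, hpol, polar_neg_right, hxa]
        simp
  -- As x pairs with u to -Q(u), the reflection in u sends x to x + u.
  · obtain ⟨r, hr, hrv⟩ := QuadraticForm.exists_reflection hQ hu
    refine ⟨r, hr, fun h hh => ?_, ?_⟩
    · rw [hrv, hHu h hh]
      simp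
    · rw [hrv, hpol, neg_mul_neg, inv_mul_cancel₀ hu, one_smul]

/-- Witt's extension theorem: two linear maps into a nondegenerate quadratic space with the same
kernel and the same pulled back form differ by an isometry. -/
theorem QuadraticForm.exists_isometry_comp_eq {U : Type*} [AddCommGroup U] [Module F U]
    [FiniteDimensional F U] (hQ : Q.polarBilin.Nondegenerate) (φ ψ : U →ₗ[F] V)
    (hform : ∀ x, Q (φ x) = Q (ψ x)) (hker : ∀ x, φ x = 0 ↔ ψ x = 0) :
    ∃ g : V ≃ₗ[F] V, (∀ v, Q (g v) = Q v) ∧ ∀ x, g (φ x) = ψ x := by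
  classical
  have main : ∀ s : Finset U, ∃ g : V ≃ₗ[F] V, (∀ v, Q (g v) = Q v) ∧
      ∀ x ∈ Submodule.span F (s : Set U), g (φ x) = ψ x := by
    intro s
    induction s using Finset.induction_on with
    | empty =>
      refine ⟨LinearEquiv.refl F V, fun _ => rfl, fun x hx => ?_⟩
      rw [Finset.coe_empty, Submodule.span_empty, Submodule.mem_bot] at hx
      rw [hx, map_zero, map_zero, map_zero]
    | insert a s _ ih =>
      obtain ⟨g, hg, hgs⟩ := ih
      -- g already matches φ with ψ on the span of s; k corrects it at a while fixing the ψ-image of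
      -- that span.
      obtain ⟨k, hk, hkH, hka⟩ := QuadraticForm.exists_isometry_fixing hQ
        (H := (Submodule.span F (s : Set U)).map ψ) (x := g (φ a)) (y := ψ a)
        (by rw [hg, hform])
        (by
          rintro _ ⟨z, hz, rfl⟩
          rw [← hgs z hz, QuadraticForm.polar_map_map (map_add g) hg, hgs z hz]
          simp only [polar, ← _root_.map_add, hform])
        (by
          rintro ⟨z, hz, hza⟩
          rw [← hgs z hz] at hza
          have h1 : φ (z - a) = 0 := by rw [map_sub, g.injective hza, sub_self]
          have h2 := (hker _).1 h1
          rw [map_sub, sub_eq_zero] at h2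
          rw [← hza, hgs z hz, h2])
        (by
          rintro ⟨z, hz, hza⟩
          have h1 : ψ (z - a) = 0 := by rw [map_sub, hza, sub_self]
          have h2 := (hker _).2 h1
          rw [map_sub, sub_eq_zero] at h2
          rw [← h2, hgs z hz, hza])
      refine ⟨g.trans k, fun v => (hk _).trans (hg v), fun x hx => ?_⟩
      rw [Finset.coe_insert, Submodule.mem_span_insert] at hx
      obtain ⟨c, z, hz, rfl⟩ := hx
      rw [LinearEquiv.trans_apply]
      simp only [_root_.map_add, _root_.map_smul, hka, hgs z hz]
      rw [hkH _ ⟨z, hz, rfl⟩]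
  obtain ⟨s, hs⟩ := (Module.Finite.fg_top : (⊤ : Submodule F U).FG)
  obtain ⟨g, hg, hgs⟩ := main s
  exact ⟨g, hg, fun x => hgs x (hs ▸ Submodule.mem_top)⟩

end QuadraticSpace

/-! ### Fixed spaces of isometries and their parity -/

section FixedSpaces

open QuadraticMap Module

variable {F V : Type*} [Field F] [AddCommGroup V] [Module F V]

variable {Q : QuadraticForm F V}

theorem LinearEquiv.mem_ker_sub_id {g : V ≃ₗ[F] V} {v : V} :
    v ∈ LinearMap.ker ((g : V →ₗ[F] V) - LinearMap.id) ↔ g v = v := by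
  rw [LinearMap.mem_ker, LinearMap.sub_apply, sub_eq_zero]
  rfl

theorem QuadraticForm.polar_sub_eq_zero_of_fixed {g : V ≃ₗ[F] V} (hg : ∀ v, Q (g v) = Q v)
    {f : V} (hf : g f = f) (v : V) : polar Q f (g v - v) = 0 := by
  rw [polar_sub_right, sub_eq_zero]
  conv_lhs => rw [← hf]
  exact QuadraticForm.polar_map_map (map_add g) hg f v

variable [FiniteDimensional F V]

/-- A pair with A(v, w) = 1 spans a plane whose orthogonal complement `ker π` has codimension 2 and
the same radical; induction splits off such planes. -/
theorem LinearMap.BilinForm.IsAlt.exists_finrank_eq {A : LinearMap.BilinForm F V} (hA : A.IsAlt) :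
    ∃ k, finrank F V = finrank F (LinearMap.ker A) + 2 * k := by
  induction hd : finrank F V using Nat.strong_induction_on generalizing V with
  | _ d ih =>
    by_cases h0 : A = 0
    · refine ⟨0, ?_⟩
      rw [h0, LinearMap.ker_zero, finrank_top, hd, mul_zero, add_zero]
    obtain ⟨v, w, hvw⟩ : ∃ v w, A v w = 1 := by
      by_contra! hcon
      apply h0
      ext v w
      by_contra hne
      apply hcon v ((A v w)⁻¹ • w)
      rw [map_smul, smul_eq_mul]
      exact inv_mul_cancel₀ hne
    have hwv : A w v = -1 := by rw [← hvw, LinearMap.BilinForm.IsAlt.neg_eq hA]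
    let π : V →ₗ[F] F × F := (A.flip v).prod (A.flip w)
    have hπ : ∀ x, π x = (A x v, A x w) := fun x => rfl
    have hsurj : LinearMap.range π = ⊤ := by
      rw [LinearMap.range_eq_top]
      rintro ⟨a, b⟩
      refine ⟨b • v - a • w, ?_⟩
      rw [hπ]
      simp [hvw, hwv, hA.self_eq_zero]
    have hrank := LinearMap.finrank_range_add_finrank_ker π
    rw [hsurj, finrank_top, finrank_prod, finrank_self] at hrank
    obtain ⟨k, hk⟩ := ih (finrank F (LinearMap.ker π)) (by omega)
      (A := A.restrict (LinearMap.ker π)) (fun x => hA x.1) rfl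
    have hker : (LinearMap.ker (A.restrict (LinearMap.ker π))).map (LinearMap.ker π).subtype =
        LinearMap.ker A := by
      ext x
      constructor
      · rintro ⟨⟨x, hxπ⟩, hx, rfl⟩
        have hx' := hxπ
        rw [LinearMap.mem_ker, hπ, Prod.mk_eq_zero] at hx'
        change A x = 0
        ext y
        have hy : y - A y w • v + A y v • w ∈ LinearMap.ker π := by
          rw [LinearMap.mem_ker, hπ]
          simp [hvw, hwv, hA.self_eq_zero]
        have := LinearMap.congr_fun (LinearMap.mem_ker.1 hx) ⟨_, hy⟩
        change A x (y - A y w • v + A y v • w) = 0 at this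
        simpa [hx'.1, hx'.2] using this
      · intro hx
        rw [LinearMap.mem_ker] at hx
        refine ⟨⟨x, ?_⟩, ?_, rfl⟩
        · rw [LinearMap.mem_ker, hπ, hx]
          rfl
        · change A.restrict (LinearMap.ker π) ⟨x, _⟩ = 0
          ext y
          change A x y = 0
          rw [hx, LinearMap.zero_apply]
    refine ⟨k + 1, ?_⟩
    rw [← hker, Submodule.finrank_map_subtype_eq]
    omega

/-- The reflection in g w - w sends g w back to w and fixes Fix(g), which is orthogonal to the image
of g - 1. Conversely, if r g v = v then g v - v is a multiple of g w - w. So the new fixed space is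
Fix(g) ⊕ ⟨w⟩. -/
theorem QuadraticForm.finrank_fixed_reflection_mul
    {g r : V ≃ₗ[F] V} (hg : ∀ v, Q (g v) = Q v) {w : V} (hu : Q (g w - w) ≠ 0)
    (hr : ∀ v, r v = v + (-(Q (g w - w))⁻¹ * polar Q v (g w - w)) • (g w - w)) :
    finrank F (LinearMap.ker (((g.trans r : V ≃ₗ[F] V) : V →ₗ[F] V) - LinearMap.id)) =
      finrank F (LinearMap.ker ((g : V →ₗ[F] V) - LinearMap.id)) + 1 := by
  have hw : w ∉ LinearMap.ker ((g : V →ₗ[F] V) - LinearMap.id) := by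
    rw [LinearEquiv.mem_ker_sub_id]
    intro h
    rw [h, sub_self, QuadraticMap.map_zero] at hu
    exact hu rfl
  have hpol : polar Q (g w) (g w - w) = Q (g w - w) := by
    have h1 : Q (g w - (g w - w)) = Q (g w) := by rw [sub_sub_cancel, hg]
    rw [sub_eq_add_neg, QuadraticMap.map_add Q, polar_neg_right, QuadraticMap.map_neg] at h1
    linear_combination -h1
  have key : LinearMap.ker (((g.trans r : V ≃ₗ[F] V) : V →ₗ[F] V) - LinearMap.id) =
      LinearMap.ker ((g : V →ₗ[F] V) - LinearMap.id) ⊔ Submodule.span F {w} := by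
    apply le_antisymm
    · intro v hv
      rw [LinearEquiv.mem_ker_sub_id, LinearEquiv.trans_apply, hr] at hv
      set c := -(Q (g w - w))⁻¹ * polar Q (g v) (g w - w)
      have : v = (v + c • w) + (-c) • w := by rw [neg_smul]; abel
      rw [this]
      refine Submodule.add_mem_sup ?_ (Submodule.smul_mem _ _ (Submodule.mem_span_singleton_self w))
      rw [LinearEquiv.mem_ker_sub_id, _root_.map_add, _root_.map_smul]
      conv_rhs => rw [← hv]
      rw [smul_sub]
      abel
    · refine sup_le (fun f hf => ?_) ?_
      · rw [LinearEquiv.mem_ker_sub_id] at hf ⊢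
        rw [LinearEquiv.trans_apply, hf, hr, QuadraticForm.polar_sub_eq_zero_of_fixed hg hf, mul_zero,
          zero_smul, add_zero]
      · rw [Submodule.span_singleton_le_iff_mem, LinearEquiv.mem_ker_sub_id,
          LinearEquiv.trans_apply, hr, hpol, neg_mul, inv_mul_cancel₀ hu, neg_smul, one_smul]
        abel
  rw [key]
  have hdisj : LinearMap.ker ((g : V →ₗ[F] V) - LinearMap.id) ⊓ Submodule.span F {w} = ⊥ := by
    rw [← disjoint_iff, Submodule.disjoint_span_singleton]
    exact fun h => absurd h hw
  have h2 := Submodule.finrank_sup_add_finrank_inf_eq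
    (LinearMap.ker ((g : V →ₗ[F] V) - LinearMap.id)) (Submodule.span F {w})
  rw [hdisj, finrank_bot, add_zero, finrank_span_singleton (by rintro rfl; exact hw (Submodule.zero_mem _))] at h2
  exact h2

/-- The image of g - 1 lies in the orthogonal complement of Fix(g), and the dimensions agree. -/
theorem QuadraticForm.exists_map_sub_eq (hQ : Q.polarBilin.Nondegenerate)
    {g : V ≃ₗ[F] V} (hg : ∀ v, Q (g v) = Q v) {u : V}
    (hu : ∀ f, g f = f → polar Q f u = 0) : ∃ w, g w - w = u := by
  have hle : LinearMap.range ((g : V →ₗ[F] V) - LinearMap.id) ≤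
      LinearMap.BilinForm.orthogonal Q.polarBilin
        (LinearMap.ker ((g : V →ₗ[F] V) - LinearMap.id)) := by
    rintro _ ⟨v, rfl⟩ f hf
    exact QuadraticForm.polar_sub_eq_zero_of_fixed hg (LinearEquiv.mem_ker_sub_id.1 hf) v
  have heq := Submodule.eq_of_le_of_finrank_eq hle (by
    have := LinearMap.finrank_range_add_finrank_ker ((g : V →ₗ[F] V) - LinearMap.id)
    rw [LinearMap.BilinForm.finrank_orthogonal hQ]
    omega)
  have hmem : u ∈ LinearMap.range ((g : V →ₗ[F] V) - LinearMap.id) := by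
    rw [heq]
    exact fun f hf => hu f (LinearEquiv.mem_ker_sub_id.1 hf)
  exact hmem

/-- Multiplying an isometry by a reflection changes the parity of the dimension of the fixed
space. -/
theorem QuadraticForm.even_finrank_fixed_reflection_mul (hQ : Q.polarBilin.Nondegenerate)
    {g r : V ≃ₗ[F] V} (hg : ∀ v, Q (g v) = Q v) {u : V} (hu : Q u ≠ 0)
    (hrQ : ∀ v, Q (r v) = Q v) (hr : ∀ v, r v = v + (-(Q u)⁻¹ * polar Q v u) • u) :
    Even (finrank F (LinearMap.ker (((g.trans r : V ≃ₗ[F] V) : V →ₗ[F] V) - LinearMap.id))) ↔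
      ¬ Even (finrank F (LinearMap.ker ((g : V →ₗ[F] V) - LinearMap.id))) := by
  by_cases h : ∀ f, g f = f → polar Q f u = 0
  · obtain ⟨w, rfl⟩ := QuadraticForm.exists_map_sub_eq hQ hg h
    rw [QuadraticForm.finrank_fixed_reflection_mul hg hu hr, Nat.even_add_one]
  -- Some f in Fix(g) is not orthogonal to u. Then r g moves a multiple of f by exactly u, so the
  -- same dimension formula applies to r g, whose product with r is g: the dimension drops by one.
  · push Not at h
    obtain ⟨f, hf, hfu⟩ := h
    have hrr : (g.trans r).trans r = g := by
      ext v
      simp only [LinearEquiv.trans_apply, hr, polar_add_left, polar_smul_left, polar_self,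
        smul_eq_mul, nsmul_eq_mul]
      rw [add_assoc, ← add_smul]
      convert add_zero _
      convert zero_smul F u
      push_cast
      field_simp
      ring
    have hw : (g.trans r) ((-(Q u) * (polar Q f u)⁻¹) • f) -
        (-(Q u) * (polar Q f u)⁻¹) • f = u := by
      rw [_root_.map_smul, ← smul_sub, LinearEquiv.trans_apply, hf, hr, add_sub_cancel_left, smul_smul]
      convert one_smul F u
      field_simp
    have hg' : ∀ v, Q ((g.trans r) v) = Q v := fun v => (hrQ _).trans (hg v)
    have := QuadraticForm.finrank_fixed_reflection_mul (g := g.trans r) (r := r) hg'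
      (w := (-(Q u) * (polar Q f u)⁻¹) • f) (by rw [hw]; exact hu) (by rw [hw]; exact hr)
    rw [hrr] at this
    rw [this, Nat.even_add_one, not_not]

/-- An isometry fixing a maximal totally singular subspace pointwise has a fixed space of even
codimension. -/
theorem QuadraticForm.exists_finrank_eq_finrank_fixed_add (hQ : Q.polarBilin.Nondegenerate)
    {g : V ≃ₗ[F] V} (hg : ∀ v, Q (g v) = Q v) {H : Submodule F V}
    (hH : LinearMap.BilinForm.orthogonal Q.polarBilin H ≤ H) (hs : ∀ h ∈ H, Q h = 0)
    (hgH : ∀ h ∈ H, g h = h) :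
    ∃ k, finrank F V = finrank F (LinearMap.ker ((g : V →ₗ[F] V) - LinearMap.id)) + 2 * k := by
  -- A(v, w) is the pairing of g v - v with w; its radical is Fix(g). It is alternating because g v
  -- - v lies in the complement of H, hence in H, and is singular.
  let A : LinearMap.BilinForm F V := Q.polarBilin ∘ₗ ((g : V →ₗ[F] V) - LinearMap.id)
  have hA : A.IsAlt := by
    intro v
    change polar Q (g v - v) v = 0
    have h1 : Q (g v - v) = 0 :=
      hs _ (hH fun h hh => QuadraticForm.polar_sub_eq_zero_of_fixed hg (hgH h hh) v)
    have h2 : Q (g v - v + v) = Q v := by rw [sub_add_cancel, hg]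
    rw [QuadraticMap.map_add Q, h1] at h2
    linear_combination h2
  have hker : LinearMap.ker A = LinearMap.ker ((g : V →ₗ[F] V) - LinearMap.id) :=
    LinearMap.ker_comp_of_ker_eq_bot _ (LinearMap.BilinForm.Nondegenerate.ker_eq_bot hQ)
  rw [← hker]
  exact hA.exists_finrank_eq

/-- If Q vanishes on the complement of H, that complement lies in its own complement, which is H;
the dimension bound then forces equality. -/
theorem QuadraticForm.exists_orthogonal_ne_zero_or (hQ : Q.polarBilin.Nondegenerate)
    {H : Submodule F V} (hd : 2 * finrank F H ≤ finrank F V) :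
    (∃ u, (∀ h ∈ H, polar Q h u = 0) ∧ Q u ≠ 0) ∨
      (2 * finrank F H = finrank F V ∧ LinearMap.BilinForm.orthogonal Q.polarBilin H ≤ H ∧
        ∀ h ∈ H, Q h = 0) := by
  by_cases h : ∃ u, (∀ h ∈ H, polar Q h u = 0) ∧ Q u ≠ 0
  · exact Or.inl h
  right
  push Not at h
  have hle : LinearMap.BilinForm.orthogonal Q.polarBilin H ≤ H := by
    intro x hx
    rw [← LinearMap.BilinForm.orthogonal_orthogonal hQ (QuadraticForm.polarBilin_isRefl Q) H]
    intro y hy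
    change polar Q y x = 0
    rw [polar, h _ hx, h _ hy, h _ (Submodule.add_mem _ hy hx)]
    simp
  have h1 := Submodule.finrank_mono hle
  have h2 := LinearMap.BilinForm.finrank_orthogonal hQ H
  have heq := Submodule.eq_of_le_of_finrank_eq hle (by omega)
  refine ⟨by omega, hle, fun x hx => ?_⟩
  rw [← heq] at hx
  exact h x hx

end FixedSpaces

/-- The fibres of I on s are exactly the orbits, and each orbit contributes |Γ| by orbit-stabiliser.
-/
theorem MulAction.sum_card_stabilizer_eq {Γ X T : Type*} [Group Γ] [Finite Γ] [MulAction Γ X]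
    [Fintype T] (s : Finset X) (I : X → T) (hs : ∀ (g : Γ), ∀ x ∈ s, g • x ∈ s)
    (hI : ∀ (g : Γ), ∀ x ∈ s, I (g • x) = I x)
    (htrans : ∀ x ∈ s, ∀ y ∈ s, I x = I y → ∃ g : Γ, g • x = y)
    (hsurj : ∀ t, ∃ x ∈ s, I x = t) :
    ∑ x ∈ s, Nat.card (MulAction.stabilizer Γ x) = Fintype.card T * Nat.card Γ := by
  classical
  cases nonempty_fintype Γ
  rw [← Finset.sum_fiberwise s I]
  have hfib : ∀ t, ∑ x ∈ s with I x = t, Nat.card (MulAction.stabilizer Γ x) = Nat.card Γ := by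
    intro t
    have hcard : ∀ x ∈ s.filter (fun x => I x = t),
        (s.filter (fun x => I x = t)).card * Nat.card (MulAction.stabilizer Γ x) = Nat.card Γ := by
      intro x hx
      rw [Finset.mem_filter] at hx
      have horb : ((s.filter (fun x => I x = t) : Finset X) : Set X) = MulAction.orbit Γ x := by
        ext y
        rw [Finset.mem_coe, Finset.mem_filter, MulAction.mem_orbit_iff]
        constructor
        · rintro ⟨hy, hyt⟩
          exact htrans x hx.1 y hy (hx.2.trans hyt.symm)
        · rintro ⟨g, rfl⟩
          exact ⟨hs g x hx.1, (hI g x hx.1).trans hx.2⟩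
      have : Fintype (MulAction.orbit Γ x) := horb ▸ (s.filter fun x => I x = t).fintypeCoeSort
      have h1 := MulAction.card_orbit_mul_card_stabilizer_eq_card_group Γ x
      rw [← Nat.card_eq_fintype_card, ← Nat.card_eq_fintype_card, ← Nat.card_eq_fintype_card,
        Nat.card_coe_set_eq, ← horb, Set.ncard_coe_finset] at h1
      exact h1
    obtain ⟨x, hx, hxt⟩ := hsurj t
    have hpos : 0 < (s.filter (fun x => I x = t)).card :=
      Finset.card_pos.2 ⟨x, Finset.mem_filter.2 ⟨hx, hxt⟩⟩
    apply Nat.eq_of_mul_eq_mul_left hpos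
    rw [Finset.mul_sum, Finset.sum_congr rfl hcard, Finset.sum_const, smul_eq_mul]
  rw [Finset.sum_congr rfl fun t _ => hfib t, Finset.sum_const, smul_eq_mul, Finset.card_univ]

/-! ### Embedding quadratic spaces in the plus-type space -/

section PlusForm

open QuadraticMap Module

variable {F : Type*} [Field F] {n : ℕ}

theorem plusForm_apply (v : (Fin n → F) × (Fin n → F)) :
    plusForm F n v = ∑ i, v.1 i * v.2 i := rfl

theorem polar_plusForm (v w : (Fin n → F) × (Fin n → F)) :
    polar (plusForm F n) v w = ∑ i, (v.1 i * w.2 i + w.1 i * v.2 i) := by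
  rw [polar, plusForm_apply, plusForm_apply, plusForm_apply, ← Finset.sum_sub_distrib,
    ← Finset.sum_sub_distrib]
  refine Finset.sum_congr rfl fun i _ => ?_
  simp only [Prod.fst_add, Prod.snd_add, Pi.add_apply]
  ring

theorem polar_plusForm_single_left (u : (Fin n → F) × (Fin n → F)) (i : Fin n) :
    polar (plusForm F n) (Pi.single i 1, 0) u = u.2 i := by
  rw [polar_plusForm]
  simp [Pi.single_apply]

theorem polar_plusForm_single_right (u : (Fin n → F) × (Fin n → F)) (i : Fin n) :
    polar (plusForm F n) (0, Pi.single i 1) u = u.1 i := by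
  rw [polar_plusForm]
  simp [Pi.single_apply]

theorem plusForm_nondegenerate : (plusForm F n).polarBilin.Nondegenerate := by
  have key : ∀ u, (∀ v, polar (plusForm F n) v u = 0) → u = 0 := fun u hu => by
    ext i
    · exact (polar_plusForm_single_right u i).symm.trans (hu _)
    · exact (polar_plusForm_single_left u i).symm.trans (hu _)
  exact ⟨fun x hx => key x fun v => by rw [polar_comm]; exact hx v, fun x hx => key x hx⟩

theorem finrank_plusSpace : finrank F ((Fin n → F) × (Fin n → F)) = 2 * n := by
  rw [finrank_prod, finrank_fin_fun, two_mul]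

/-- Every quadratic form on a space of dimension at most `n` is induced by a linear embedding into
the quadratic space of plus type of dimension `2n`. -/
theorem exists_injective_plusForm_eq {U : Type*} [AddCommGroup U] [Module F U]
    [FiniteDimensional F U] (hU : finrank F U ≤ n) (q : QuadraticForm F U) :
    ∃ φ : U →ₗ[F] (Fin n → F) × (Fin n → F), Function.Injective φ ∧
      ∀ x, plusForm F n (φ x) = q x := by
  obtain ⟨B, rfl⟩ := LinearMap.BilinMap.toQuadraticMap_surjective q
  obtain ⟨e, he⟩ : ∃ e : U →ₗ[F] (Fin n → F), Function.Injective e := by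
    rw [← finrank_le_iff_exists_linearMap]
    rwa [finrank_fin_fun]
  obtain ⟨p, hp⟩ := e.exists_leftInverse_of_injective (LinearMap.ker_eq_bot.2 he)
  -- Write q(x) = B(x, x), possible in any characteristic, and send x to (e x, (B(x, p eᵢ))ᵢ). The
  -- form there is B(x, p (e x)) = B(x, x).
  refine ⟨e.prod (LinearMap.pi fun i => B.flip (p fun j => if i = j then 1 else 0)),
    fun x y hxy => he (congrArg Prod.fst hxy), fun x => ?_⟩
  rw [LinearMap.BilinMap.toQuadraticMap_apply]
  have h1 : p (e x) = x := LinearMap.congr_fun hp x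
  conv_rhs => rw [← h1]
  refine Eq.trans ?_ (LinearMap.pi_apply_eq_sum_univ (B (p (e x)) ∘ₗ p) (e x)).symm
  rw [h1]
  rfl

/-- Extend the form to H × F so that (0, 1) has the prescribed value and pairings. This space has
dimension at most n, so it embeds; Witt's theorem moves the copy of H back onto H. -/
theorem exists_notMem_plusForm_eq {H : Submodule F ((Fin n → F) × (Fin n → F))}
    (hH : finrank F H < n) (f : H →ₗ[F] F) (c : F) :
    ∃ x, x ∉ H ∧ (∀ h : H, polar (plusForm F n) h x = f h) ∧ plusForm F n x = c := by
  let q : QuadraticForm F (H × F) := (plusForm F n).comp (H.subtype ∘ₗ LinearMap.fst F H F) +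
    linMulLin (LinearMap.snd F H F) (f ∘ₗ LinearMap.fst F H F) +
    c • linMulLin (LinearMap.snd F H F) (LinearMap.snd F H F)
  have hq : ∀ h s, q (h, s) = plusForm F n h + s * f h + c * (s * s) := fun h s => rfl
  obtain ⟨φ, hφ, hφq⟩ := exists_injective_plusForm_eq (n := n)
    (by rw [finrank_prod, finrank_self]; omega) q
  obtain ⟨g, hg, hgφ⟩ := QuadraticForm.exists_isometry_comp_eq plusForm_nondegenerate
    (φ ∘ₗ LinearMap.inl F H F) H.subtype
    (fun h => by
      change plusForm F n (φ (h, 0)) = plusForm F n h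
      rw [hφq, hq]
      ring)
    (fun h => by
      rw [LinearMap.comp_apply, map_eq_zero_iff φ hφ, map_eq_zero_iff _ LinearMap.inl_injective,
        map_eq_zero_iff _ H.subtype_injective])
  have hgφ' : ∀ h : H, (h : (Fin n → F) × (Fin n → F)) = g (φ (h, 0)) := fun h => (hgφ h).symm
  refine ⟨g (φ (0, 1)), fun hmem => ?_, fun h => ?_, ?_⟩
  · have h1 := hφ (g.injective (hgφ' ⟨_, hmem⟩))
    exact one_ne_zero (congrArg Prod.snd h1)
  · rw [hgφ' h, polar, ← _root_.map_add, ← _root_.map_add, hg, hg, hg, hφq, hφq, hφq, Prod.mk_add_mk, hq, hq, hq]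
    simp only [add_zero, zero_add, one_mul, zero_mul, mul_zero, mul_one, ZeroMemClass.coe_zero, _root_.map_zero]
    ring
  · rw [hg, hφq, hq]
    simp

end PlusForm

/-! ### Summing stabiliser orders over tuples -/

section Counting

open QuadraticMap Module

variable {F : Type*} [Field F] {n : ℕ}

theorem mem_fixingSubgroup_span_iff {s : Set ((Fin n → F) × (Fin n → F))}
    {g : orthogonalPlus F n} :
    g ∈ fixingSubgroup (orthogonalPlus F n) s ↔ ∀ h ∈ Submodule.span F s, g.1 h = h := by
  rw [mem_fixingSubgroup_iff]
  refine ⟨fun hg => ?_, fun hg y hy => hg y (Submodule.subset_span hy)⟩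
  change Submodule.span F s ≤ fixedSpace g
  exact Submodule.span_le.2 hg

theorem card_fixingSubgroup_insert (s : Set ((Fin n → F) × (Fin n → F)))
    (x : (Fin n → F) × (Fin n → F)) :
    Nat.card (fixingSubgroup (orthogonalPlus F n) (insert x s)) =
      Nat.card (MulAction.stabilizer (fixingSubgroup (orthogonalPlus F n) s) x) := by
  have hmem : ∀ g : orthogonalPlus F n, g ∈ fixingSubgroup (orthogonalPlus F n) (insert x s) ↔
      g • x = x ∧ g ∈ fixingSubgroup (orthogonalPlus F n) s := fun g => by
    rw [mem_fixingSubgroup_iff, mem_fixingSubgroup_iff, Set.forall_mem_insert]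
  exact Nat.card_congr
    { toFun := fun g => ⟨⟨g.1, ((hmem _).1 g.2).2⟩, ((hmem _).1 g.2).1⟩
      invFun := fun g => ⟨g.1.1, (hmem _).2 ⟨g.2, g.1.2⟩⟩
      left_inv := fun _ => rfl
      right_inv := fun _ => rfl }

theorem fixingSubgroup_insert_of_mem_span {s : Set ((Fin n → F) × (Fin n → F))}
    {x : (Fin n → F) × (Fin n → F)} (hx : x ∈ Submodule.span F s) :
    fixingSubgroup (orthogonalPlus F n) (insert x s) = fixingSubgroup (orthogonalPlus F n) s := by
  ext g
  rw [mem_fixingSubgroup_span_iff, mem_fixingSubgroup_span_iff, Submodule.span_insert_eq_span hx]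

theorem finrank_span_insert_of_notMem {s : Set ((Fin n → F) × (Fin n → F))}
    {x : (Fin n → F) × (Fin n → F)} (hx : x ∉ Submodule.span F s) :
    finrank F (Submodule.span F (insert x s)) = finrank F (Submodule.span F s) + 1 := by
  have hdisj : Submodule.span F {x} ⊓ Submodule.span F s = ⊥ := by
    rw [← disjoint_iff, disjoint_comm, Submodule.disjoint_span_singleton]
    exact fun h => absurd h hx
  have h2 := Submodule.finrank_sup_add_finrank_inf_eq (Submodule.span F {x}) (Submodule.span F s)
  rw [hdisj, finrank_bot, add_zero, ← Submodule.span_insert, finrank_span_singleton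
    (by rintro rfl; exact hx (Submodule.zero_mem _)), add_comm 1] at h2
  exact h2

variable [Fintype F]

open Classical in
/-- Outside the span of `s`, the orbits of the pointwise stabiliser of `s` are classified by the
value of the quadratic form and by the functional induced on the span. -/
theorem sum_card_fixingSubgroup_insert_notMem {s : Set ((Fin n → F) × (Fin n → F))}
    (hs : finrank F (Submodule.span F s) < n) :
    ∑ x with x ∉ Submodule.span F s,
        Nat.card (fixingSubgroup (orthogonalPlus F n) (insert x s)) =
      Fintype.card F ^ (finrank F (Submodule.span F s) + 1) *
        Nat.card (fixingSubgroup (orthogonalPlus F n) s) := by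
  set H := Submodule.span F s
  have : Finite (H →ₗ[F] F) := Module.finite_of_finite F
  have : Fintype (H →ₗ[F] F) := Fintype.ofFinite _
  let I : (Fin n → F) × (Fin n → F) → (H →ₗ[F] F) × F := fun x =>
    ((plusForm F n).polarBilin.flip x ∘ₗ H.subtype, plusForm F n x)
  have hI : ∀ x y, I x = I y ↔
      (∀ h ∈ H, polar (plusForm F n) h x = polar (plusForm F n) h y) ∧
        plusForm F n x = plusForm F n y := fun x y => by
    rw [Prod.ext_iff, LinearMap.ext_iff, Subtype.forall]
    rfl
  have hfix : ∀ g : fixingSubgroup (orthogonalPlus F n) s, ∀ h ∈ H, g.1.1 h = h := fun g =>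
    mem_fixingSubgroup_span_iff.1 g.2
  simp only [card_fixingSubgroup_insert]
  rw [MulAction.sum_card_stabilizer_eq _ I]
  · congr 1
    rw [Fintype.card_prod, Module.card_eq_pow_finrank (K := F) (V := H →ₗ[F] F),
      finrank_linearMap_self, pow_succ]
  · intro g x hx
    rw [Finset.mem_filter_univ] at hx ⊢
    intro hgx
    apply hx
    -- If g x were in H, g would fix it, and injectivity would give g x = x.
    have h1 : g.1.1 (g.1.1 x) = g.1.1 x := hfix g _ hgx
    have h2 : g • x = x := g.1.1.injective h1
    rwa [h2] at hgx
  · intro g x _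
    rw [hI]
    refine ⟨fun h hh => ?_, g.1.2 x⟩
    conv_lhs => rw [← hfix g h hh]
    exact QuadraticForm.polar_map_map (map_add g.1.1) g.1.2 h x
  · intro x hx y hy hxy
    rw [Finset.mem_filter_univ] at hx hy
    obtain ⟨h1, h2⟩ := (hI x y).1 hxy
    obtain ⟨g, hg, hgH, hgx⟩ := QuadraticForm.exists_isometry_fixing plusForm_nondegenerate h2 h1
      (fun h => absurd h hx) (fun h => absurd h hy)
    exact ⟨⟨⟨g, hg⟩, mem_fixingSubgroup_span_iff.2 hgH⟩, hgx⟩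
  · rintro ⟨f, c⟩
    obtain ⟨x, hx, hxf, hxc⟩ := exists_notMem_plusForm_eq hs f c
    exact ⟨x, Finset.mem_filter_univ _ |>.2 hx, Prod.ext (LinearMap.ext hxf) hxc⟩

theorem sum_card_fixingSubgroup_insert {s : Set ((Fin n → F) × (Fin n → F))}
    (hs : finrank F (Submodule.span F s) < n) (t : ℝ) :
    ∑ x, t ^ finrank F (Submodule.span F (insert x s)) *
        (Nat.card (fixingSubgroup (orthogonalPlus F n) (insert x s)) : ℝ) =
      (1 + Fintype.card F * t) * ((Fintype.card F * t) ^ finrank F (Submodule.span F s) *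
        (Nat.card (fixingSubgroup (orthogonalPlus F n) s) : ℝ)) := by
  classical
  rw [← Finset.sum_filter_add_sum_filter_not Finset.univ (fun x => x ∈ Submodule.span F s)]
  have h1 : ∀ x ∈ Finset.univ.filter (fun x => x ∈ Submodule.span F s),
      t ^ finrank F (Submodule.span F (insert x s)) *
        (Nat.card (fixingSubgroup (orthogonalPlus F n) (insert x s)) : ℝ) =
      t ^ finrank F (Submodule.span F s) *
        (Nat.card (fixingSubgroup (orthogonalPlus F n) s) : ℝ) := fun x hx => by
    rw [Finset.mem_filter_univ] at hx
    rw [fixingSubgroup_insert_of_mem_span hx, Submodule.span_insert_eq_span hx]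
  have h2 : ∀ x ∈ Finset.univ.filter (fun x => x ∉ Submodule.span F s),
      t ^ finrank F (Submodule.span F (insert x s)) *
        (Nat.card (fixingSubgroup (orthogonalPlus F n) (insert x s)) : ℝ) =
      t ^ (finrank F (Submodule.span F s) + 1) *
        (Nat.card (fixingSubgroup (orthogonalPlus F n) (insert x s)) : ℝ) := fun x hx => by
    rw [Finset.mem_filter_univ] at hx
    rw [finrank_span_insert_of_notMem hx]
  have hcard : (Finset.univ.filter (fun x => x ∈ Submodule.span F s)).card =
      Fintype.card F ^ finrank F (Submodule.span F s) := by
    rw [← Fintype.card_subtype]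
    exact Module.card_eq_pow_finrank (K := F) (V := Submodule.span F s)
  rw [Finset.sum_congr rfl h1, Finset.sum_congr rfl h2, Finset.sum_const, ← Finset.mul_sum,
    ← Nat.cast_sum, sum_card_fixingSubgroup_insert_notMem hs, hcard, nsmul_eq_mul]
  push_cast
  ring

/-- Peeling off one vector gives the factor 1 + q t and the same sum at q t, so the induction must
cover all t although only t = 1 is needed. -/
theorem sum_card_fixingSubgroup_range {j : ℕ} (hj : j ≤ n) (t : ℝ) :
    ∑ v : Fin j → (Fin n → F) × (Fin n → F), t ^ finrank F (Submodule.span F (Set.range v)) *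
        (Nat.card (fixingSubgroup (orthogonalPlus F n) (Set.range v)) : ℝ) =
      Nat.card (orthogonalPlus F n) *
        ∏ i ∈ Finset.range j, (1 + (Fintype.card F : ℝ) ^ (i + 1) * t) := by
  induction j generalizing t with
  | zero =>
    have h1 : fixingSubgroup (orthogonalPlus F n) (∅ : Set ((Fin n → F) × (Fin n → F))) = ⊤ := by
      ext g
      simp
    rw [Fintype.sum_unique, Set.range_eq_empty, Submodule.span_empty, finrank_bot, h1,
      Nat.card_congr Subgroup.topEquiv.toEquiv]
    simp
  | succ j ih =>
    rw [← (Fin.consEquiv fun _ => (Fin n → F) × (Fin n → F)).sum_comp, Fintype.sum_prod_type_right]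
    have hlt : ∀ v : Fin j → (Fin n → F) × (Fin n → F),
        finrank F (Submodule.span F (Set.range v)) < n := fun v =>
      ((finrank_range_le_card v).trans_eq (Fintype.card_fin j)).trans_lt hj
    have hrange : ∀ x (v : Fin j → (Fin n → F) × (Fin n → F)), Set.range
        (Fin.consEquiv (fun _ => (Fin n → F) × (Fin n → F)) (x, v)) = insert x (Set.range v) :=
      Fin.range_cons
    rw [Finset.sum_congr rfl fun v _ => (Finset.sum_congr rfl fun x _ => by rw [hrange]).trans
      (sum_card_fixingSubgroup_insert (hlt v) t), ← Finset.mul_sum, ih (by omega),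
      Finset.prod_range_succ']
    simp only [pow_succ]
    simp only [pow_zero, one_mul, mul_assoc]
    ring

end Counting

/-! ### Unsigned and signed moments -/

section Averages

open QuadraticMap Module

variable {F : Type*} [Field F] {n : ℕ}

theorem fixedSpace_eq_ker (g : orthogonalPlus F n) :
    fixedSpace g = LinearMap.ker ((g.1 : ((Fin n → F) × (Fin n → F)) →ₗ[F] _) - LinearMap.id) := by
  ext v
  rw [LinearEquiv.mem_ker_sub_id]
  rfl

/-- The tuples `v` whose orthogonal complement is totally singular. -/
def IsCoisotropicTuple {j : ℕ} (v : Fin j → (Fin n → F) × (Fin n → F)) : Prop :=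
  ∀ u, (∀ i, polar (plusForm F n) (v i) u = 0) → plusForm F n u = 0

theorem IsCoisotropicTuple.lagrangian {j : ℕ} {v : Fin j → (Fin n → F) × (Fin n → F)}
    (hj : j ≤ n) (hv : IsCoisotropicTuple v) :
    finrank F (Submodule.span F (Set.range v)) = n ∧
      LinearMap.BilinForm.orthogonal (plusForm F n).polarBilin (Submodule.span F (Set.range v)) ≤
        Submodule.span F (Set.range v) ∧
      ∀ h ∈ Submodule.span F (Set.range v), plusForm F n h = 0 := by
  have hle : finrank F (Submodule.span F (Set.range v)) ≤ j :=
    (finrank_range_le_card v).trans_eq (Fintype.card_fin j)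
  rcases QuadraticForm.exists_orthogonal_ne_zero_or plusForm_nondegenerate
    (H := Submodule.span F (Set.range v)) (by rw [finrank_plusSpace]; omega) with h | h
  · obtain ⟨u, hu, hne⟩ := h
    exact absurd (hv u fun i => hu _ (Submodule.subset_span ⟨i, rfl⟩)) hne
  · rw [finrank_plusSpace] at h
    exact ⟨by omega, h.2⟩

theorem IsCoisotropicTuple.even_finrank_fixedSpace {j : ℕ}
    {v : Fin j → (Fin n → F) × (Fin n → F)} (hj : j ≤ n) (hv : IsCoisotropicTuple v)
    {g : orthogonalPlus F n} (hg : g ∈ fixingSubgroup (orthogonalPlus F n) (Set.range v)) :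
    Even (finrank F (fixedSpace g)) := by
  obtain ⟨-, h1, h2⟩ := hv.lagrangian hj
  obtain ⟨k, hk⟩ := QuadraticForm.exists_finrank_eq_finrank_fixed_add plusForm_nondegenerate g.2
    h1 h2 (mem_fixingSubgroup_span_iff.1 hg)
  rw [finrank_plusSpace, ← fixedSpace_eq_ker] at hk
  exact ⟨n - k, by omega⟩

theorem IsCoisotropicTuple.smul {j : ℕ} {v : Fin j → (Fin n → F) × (Fin n → F)}
    (hv : IsCoisotropicTuple v) (g : orthogonalPlus F n) : IsCoisotropicTuple (g • v) := by
  intro u hu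
  rw [← (g⁻¹).2 u]
  refine hv _ fun i => ?_
  rw [← QuadraticForm.polar_map_map (map_add g.1) g.2]
  have : g.1 ((g⁻¹ : orthogonalPlus F n).1 u) = u := smul_inv_smul g u
  rw [this]
  exact hu i

/-- Both tuples are bases of totally singular n-spaces, so Witt's theorem applies to their linear
combination maps. -/
theorem IsCoisotropicTuple.exists_smul_eq {v w : Fin n → (Fin n → F) × (Fin n → F)}
    (hv : IsCoisotropicTuple v) (hw : IsCoisotropicTuple w) :
    ∃ g : orthogonalPlus F n, g • v = w := by
  have key : ∀ v : Fin n → (Fin n → F) × (Fin n → F), IsCoisotropicTuple v →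
      Function.Injective (Fintype.linearCombination F v) ∧
        ∀ x, plusForm F n (Fintype.linearCombination F v x) = 0 := by
    intro v hv
    obtain ⟨h1, -, h2⟩ := hv.lagrangian le_rfl
    constructor
    · have : LinearIndependent F v := by
        rw [linearIndependent_iff_card_eq_finrank_span, Fintype.card_fin, Set.finrank, h1]
      exact LinearIndependent.fintypeLinearCombination_injective this
    · intro x
      apply h2
      rw [← Fintype.range_linearCombination F]
      exact ⟨x, rfl⟩
  obtain ⟨hv1, hv2⟩ := key v hv
  obtain ⟨hw1, hw2⟩ := key w hw
  obtain ⟨g, hg, hgv⟩ := QuadraticForm.exists_isometry_comp_eq plusForm_nondegenerate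
    (Fintype.linearCombination F v) (Fintype.linearCombination F w)
    (fun x => by rw [hv2, hw2])
    (fun x => by rw [map_eq_zero_iff _ hv1, map_eq_zero_iff _ hw1])
  refine ⟨⟨g, hg⟩, funext fun i => ?_⟩
  have := hgv (Pi.single i 1)
  rwa [Fintype.linearCombination_apply_single, Fintype.linearCombination_apply_single, one_smul,
    one_smul] at this

theorem isCoisotropicTuple_single :
    IsCoisotropicTuple (fun i : Fin n => ((Pi.single i 1, 0) : (Fin n → F) × (Fin n → F))) := by
  intro u hu
  rw [plusForm_apply]
  refine Finset.sum_eq_zero fun i _ => ?_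
  rw [← polar_plusForm_single_left, hu, mul_zero]

variable [Fintype F]

open Classical in
-- Expand the power as a count of fixed tuples and exchange sums. The weight is later 1 or the
-- parity sign.
theorem sum_mul_numFixed_pow (w : orthogonalPlus F n → ℝ) (j : ℕ) :
    ∑ g, w g * (numFixed g : ℝ) ^ j = ∑ v : Fin j → (Fin n → F) × (Fin n → F),
      ∑ g with g ∈ fixingSubgroup (orthogonalPlus F n) (Set.range v), w g := by
  have hmem : ∀ (g : orthogonalPlus F n) (v : Fin j → (Fin n → F) × (Fin n → F)),
      g ∈ fixingSubgroup (orthogonalPlus F n) (Set.range v) ↔ ∀ i, v i ∈ fixedSpace g := by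
    intro g v
    rw [mem_fixingSubgroup_iff, Set.forall_mem_range]
    rfl
  have hpow : ∀ g : orthogonalPlus F n, (numFixed g : ℝ) ^ j =
      ∑ v : Fin j → (Fin n → F) × (Fin n → F),
        if g ∈ fixingSubgroup (orthogonalPlus F n) (Set.range v) then 1 else 0 := by
    intro g
    rw [Finset.sum_boole, ← Fintype.card_subtype, ← Nat.card_eq_fintype_card, numFixed]
    norm_cast
    have hc := Nat.card_fun (α := Fin j) (β := fixedSpace g)
    rw [Nat.card_eq_fintype_card (α := Fin j), Fintype.card_fin] at hc
    rw [← hc]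
    refine Nat.card_congr ((Equiv.subtypePiEquivPi (p := fun _ x => x ∈ fixedSpace g)).symm.trans
      (Equiv.subtypeEquivRight fun v => (hmem g v).symm))
  simp only [hpow, Finset.mul_sum, Finset.sum_filter, mul_ite, mul_one, mul_zero]
  exact Finset.sum_comm

theorem sum_numFixed_pow {j : ℕ} (hj : j ≤ n) :
    ∑ g : orthogonalPlus F n, (numFixed g : ℝ) ^ j =
      Fintype.card (orthogonalPlus F n) *
        ∏ i ∈ Finset.Icc 1 j, ((Fintype.card F : ℝ) ^ i + 1) := by
  classical
  have h1 := sum_mul_numFixed_pow (F := F) (n := n) (fun _ => 1) j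
  have h2 := sum_card_fixingSubgroup_range (F := F) hj 1
  have h3 : ∏ i ∈ Finset.Icc 1 j, ((Fintype.card F : ℝ) ^ i + 1) =
      ∏ i ∈ Finset.range j, (1 + (Fintype.card F : ℝ) ^ (i + 1) * 1) := by
    rw [Finset.range_eq_Ico, ← Finset.Ico_add_one_right_eq_Icc]
    rw [Finset.prod_Ico_add' (fun i => 1 + (Fintype.card F : ℝ) ^ i * 1) 0 j 1]
    simp only [zero_add, mul_one, add_comm]
  rw [h3, ← Nat.card_eq_fintype_card, ← h2]
  simp only [one_mul] at h1
  rw [h1]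
  refine Finset.sum_congr rfl fun v _ => ?_
  rw [Finset.sum_const, nsmul_eq_mul, mul_one, one_pow, one_mul, ← Fintype.card_subtype,
    ← Nat.card_eq_fintype_card]

open Classical in
-- Left multiplication by the reflection in u is a sign-reversing bijection of the stabiliser.
theorem sum_fixingSubgroup_sign_eq_zero {j : ℕ} {v : Fin j → (Fin n → F) × (Fin n → F)}
    {u : (Fin n → F) × (Fin n → F)} (hvu : ∀ i, polar (plusForm F n) (v i) u = 0)
    (hu : plusForm F n u ≠ 0) :
    ∑ g with g ∈ fixingSubgroup (orthogonalPlus F n) (Set.range v),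
      (-1 : ℝ) ^ finrank F (fixedSpace g) = 0 := by
  obtain ⟨r, hrQ, hr⟩ := QuadraticForm.exists_reflection plusForm_nondegenerate hu
  let R : orthogonalPlus F n := ⟨r, hrQ⟩
  have hR : R ∈ fixingSubgroup (orthogonalPlus F n) (Set.range v) := by
    rw [mem_fixingSubgroup_iff, Set.forall_mem_range]
    intro i
    change r (v i) = v i
    rw [hr, hvu, mul_zero, zero_smul, add_zero]
  have hsign : ∀ g : orthogonalPlus F n, (-1 : ℝ) ^ finrank F (fixedSpace (R * g)) =
      -(-1 : ℝ) ^ finrank F (fixedSpace g) := by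
    intro g
    have h := QuadraticForm.even_finrank_fixed_reflection_mul plusForm_nondegenerate g.2 hu hrQ hr
    rw [← fixedSpace_eq_ker g] at h
    have h' : Even (finrank F (fixedSpace (R * g))) ↔ ¬ Even (finrank F (fixedSpace g)) := by
      rw [← h, fixedSpace_eq_ker (R * g)]
      rfl
    by_cases hg : Even (finrank F (fixedSpace g))
    · rw [hg.neg_one_pow, (Nat.not_even_iff_odd.1 fun h1 => h'.1 h1 hg).neg_one_pow]
    · rw [(h'.2 hg).neg_one_pow, (Nat.not_even_iff_odd.1 hg).neg_one_pow, neg_neg]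
  have key : ∑ g with g ∈ fixingSubgroup (orthogonalPlus F n) (Set.range v),
      (-1 : ℝ) ^ finrank F (fixedSpace g) =
      ∑ g with g ∈ fixingSubgroup (orthogonalPlus F n) (Set.range v),
        -(-1 : ℝ) ^ finrank F (fixedSpace g) := by
    symm
    refine Finset.sum_equiv (Equiv.mulLeft R) (fun g => ?_) fun g _ => ?_
    · rw [Finset.mem_filter_univ, Finset.mem_filter_univ, Equiv.coe_mulLeft,
        Subgroup.mul_mem_cancel_left _ hR]
    · rw [Equiv.coe_mulLeft, hsign]
  rw [Finset.sum_neg_distrib] at key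
  linarith

theorem sum_sign_mul_numFixed_pow {j : ℕ} (hj : j ≤ n) :
    ∑ g : orthogonalPlus F n, (-1 : ℝ) ^ finrank F (fixedSpace g) * (numFixed g : ℝ) ^ j =
      Fintype.card (orthogonalPlus F n) * if n = j then 1 else 0 := by
  classical
  rw [sum_mul_numFixed_pow]
  have hzero : ∀ v : Fin j → (Fin n → F) × (Fin n → F), ¬ IsCoisotropicTuple v →
      ∑ g with g ∈ fixingSubgroup (orthogonalPlus F n) (Set.range v),
        (-1 : ℝ) ^ finrank F (fixedSpace g) = 0 := by
    intro v hv
    rw [IsCoisotropicTuple] at hv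
    push Not at hv
    obtain ⟨u, hvu, hu⟩ := hv
    exact sum_fixingSubgroup_sign_eq_zero hvu hu
  have hcard : ∀ v : Fin j → (Fin n → F) × (Fin n → F), IsCoisotropicTuple v →
      ∑ g with g ∈ fixingSubgroup (orthogonalPlus F n) (Set.range v),
        (-1 : ℝ) ^ finrank F (fixedSpace g) =
      (Nat.card (MulAction.stabilizer (orthogonalPlus F n) v) : ℝ) := by
    intro v hv
    rw [Finset.sum_congr rfl fun g hg =>
      (hv.even_finrank_fixedSpace hj (Finset.mem_filter_univ _ |>.1 hg)).neg_one_pow,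
      Finset.sum_const, nsmul_eq_mul, mul_one, ← Fintype.card_subtype, ← Nat.card_eq_fintype_card]
    congr 1
    refine Nat.card_congr (Equiv.subtypeEquivRight fun g => ?_)
    rw [mem_fixingSubgroup_iff, Set.forall_mem_range, MulAction.mem_stabilizer_iff, funext_iff]
    rfl
  rw [← Finset.sum_filter_add_sum_filter_not Finset.univ IsCoisotropicTuple,
    Finset.sum_congr rfl fun v hv => hcard v (Finset.mem_filter_univ _ |>.1 hv),
    Finset.sum_eq_zero (s := Finset.univ.filter fun v => ¬ IsCoisotropicTuple v)
      fun v hv => hzero v (Finset.mem_filter.1 hv).2, add_zero, ← Nat.cast_sum]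
  split_ifs with hnj
  · subst hnj
    -- A constant invariant: the coisotropic n-tuples form a single orbit.
    rw [MulAction.sum_card_stabilizer_eq _ (fun _ => ()), Nat.card_eq_fintype_card,
      Fintype.card_unit, one_mul, mul_one]
    · intro g v hv
      rw [Finset.mem_filter_univ] at hv ⊢
      exact hv.smul g
    · intros
      rfl
    · intro v hv w hw _
      rw [Finset.mem_filter_univ] at hv hw
      exact hv.exists_smul_eq hw
    · exact fun _ => ⟨_, Finset.mem_filter_univ _ |>.2 isCoisotropicTuple_single, rfl⟩
  -- For j < n no coisotropic tuple exists, since j vectors cannot span dimension n.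
  · rw [Finset.filter_false_of_mem, Finset.sum_empty, Nat.cast_zero, mul_zero]
    intro v _ hv
    have h1 := (hv.lagrangian hj).1
    have h2 : finrank F (Submodule.span F (Set.range v)) ≤ j :=
      (finrank_range_le_card v).trans_eq (Fintype.card_fin j)
    omega

end Averages

/-! ### Separating even and odd fixed-space dimensions -/

open Classical in
theorem mainTheorem5 (F : Type*) [Field F] [Fintype F] (j n : ℕ) (hjn : j ≤ n) :
    (𝔼 g : orthogonalPlus F n, (numFixed g : ℝ) ^ j)
        = ∏ i ∈ Finset.Icc 1 j, ((Fintype.card F : ℝ) ^ i + 1) ∧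
    (𝔼 g : orthogonalPlus F n,
        (if Even (Module.finrank F (fixedSpace g)) then (numFixed g : ℝ) ^ j else 0))
        = (1 / 2 : ℝ) * ((∏ i ∈ Finset.Icc 1 j, ((Fintype.card F : ℝ) ^ i + 1))
            + if n = j then 1 else 0) ∧
    (𝔼 g : orthogonalPlus F n,
        (if Odd (Module.finrank F (fixedSpace g)) then (numFixed g : ℝ) ^ j else 0))
        = (1 / 2 : ℝ) * ((∏ i ∈ Finset.Icc 1 j, ((Fintype.card F : ℝ) ^ i + 1))
            - if n = j then 1 else 0) := by
  have hc : (Fintype.card (orthogonalPlus F n) : ℝ) ≠ 0 := Nat.cast_ne_zero.2 Fintype.card_ne_zero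
  have hS := sum_numFixed_pow (F := F) hjn
  have hD := sum_sign_mul_numFixed_pow (F := F) hjn
  have heven : ∀ g : orthogonalPlus F n,
      (if Even (Module.finrank F (fixedSpace g)) then (numFixed g : ℝ) ^ j else 0) =
        (1 / 2) * ((numFixed g : ℝ) ^ j +
          (-1 : ℝ) ^ Module.finrank F (fixedSpace g) * (numFixed g : ℝ) ^ j) := by
    intro g
    split_ifs with h
    · rw [h.neg_one_pow]
      ring
    · rw [(Nat.not_even_iff_odd.1 h).neg_one_pow]
      ring
  have hodd : ∀ g : orthogonalPlus F n,
      (if Odd (Module.finrank F (fixedSpace g)) then (numFixed g : ℝ) ^ j else 0) =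
        (1 / 2) * ((numFixed g : ℝ) ^ j -
          (-1 : ℝ) ^ Module.finrank F (fixedSpace g) * (numFixed g : ℝ) ^ j) := by
    intro g
    split_ifs with h
    · rw [h.neg_one_pow]
      ring
    · rw [(Nat.not_odd_iff_even.1 h).neg_one_pow]
      ring
  refine ⟨?_, ?_, ?_⟩
  · rw [Fintype.expect_eq_sum_div_card, hS, mul_div_cancel_left₀ _ hc]
  · rw [Fintype.expect_eq_sum_div_card, Finset.sum_congr rfl fun g _ => heven g, ← Finset.mul_sum,
      Finset.sum_add_distrib, hS, hD, ← mul_add, mul_left_comm, mul_div_cancel_left₀ _ hc]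
  · rw [Fintype.expect_eq_sum_div_card, Finset.sum_congr rfl fun g _ => hodd g, ← Finset.mul_sum,
      Finset.sum_sub_distrib, hS, hD, ← mul_sub, mul_left_comm, mul_div_cancel_left₀ _ hc]
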